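/- Let $q\in\mathbb C\setminus\{0,\pm1,\pm i\}$ and let $\mathcal A=\mathrm{Fun}_q(\mathrm{GL}(3,\mathbb C))$ be the complex unital algebra generated by $z^i{}_j$ $(1\le i,j\le 3)$ and $\mathcal D^{-1}$ with relations $$z^i{}_jz^i{}_k=q\,z^i{}_kz^i{}_j\ (j<k),\qquad z^i{}_jz^k{}_j=q\,z^k{}_jz^i{}_j\ (i<k),\qquad z^i{}_jz^k{}_l=z^k{}_lz^i{}_j\ (i<k,\ j>l),$$ $$z^i{}_jz^k{}_l=z^k{}_lz^i{}_j+(q-q^{-1})z^k{}_jz^i{}_l\ (i<k,\ j<l),\qquad \mathcal D\mathcal D^{-1}=\mathcal D^{-1}\mathcal D=1,$$ where $\mathcal D=z^1{}_1z^2{}_2z^3{}_3+q^2z^1{}_2z^2{}_3z^3{}_1+q^2z^1{}_3z^2{}_1z^3{}_2-q\,z^1{}_1z^2{}_3z^3{}_2-q^3z^1{}_3z^2{}_2z^3{}_1-q\,z^1{}_2z^2{}_1z^3{}_3$ is the quantum determinant. It is a Hopf algebra with $\Delta(z^i{}_j)=\sum_kz^i{}_k\otimes z^k{}_j$, $\varepsilon(z^i{}_j)=\delta^i{}_j$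 and antipode $S$, where $(S(z^i{}_j))$ is the inverse of the matrix $(z^i{}_j)$. A first order differential calculus over $\mathcal A$ is an $\mathcal A$-bimodule $\Gamma$ with a linear map $d:\mathcal A\to\Gamma$ satisfying $d(ab)=(da)b+a(db)$ and such that $d\mathcal A$ generates $\Gamma$ as a left $\mathcal A$-module. It is bicovariant if there are linear maps $\Delta_L:\Gamma\to\mathcal A\otimes\Gamma$ and $\Delta_R:\Gamma\to\Gamma\otimes\mathcal A$ with $\Delta_L(a\,db)=\Delta(a)(\mathrm{id}\otimes d)\Delta(b)$ and $\Delta_R(a\,db)=\Delta(a)(d\otimes\mathrm{id})\Delta(b)$ for all $a,b\in\mathcal A$. Put $$\theta^i{}_j=\sum_kS(z^i{}_k)\,dz^k{}_j,\qquad \mathrm{Tr}_q\theta=q^4\theta^1{}_1+q^2\theta^2{}_2+\theta^3{}_3 .$$ Let $t\in\mathbb C\setminus\{0\}$ and write $T=\mathrm{Tr}_q\theta$, $\lambda=q-q^{-1}$. A bicovariant first order differential calculus over $\mathcal A$ which is generated by the $dz^i{}_j$ as a left $\mathcal A$-module is called a calculus $\Gamma_1(t)$, where $(q^6+q^4+1)t-(q^6+q^4+q^2)\ne0$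 is required, if $$\begin{aligned} (dz^i{}_j)z^i{}_j&=(tq^{-2}+t-1)z^i{}_j\,dz^i{}_j+\sigma z^i{}_jz^i{}_jT,\\ (dz^i{}_j)z^i{}_l&=tq^{-1}z^i{}_l\,dz^i{}_j+(t-1)z^i{}_j\,dz^i{}_l+\sigma z^i{}_jz^i{}_lT &&(j<l),\\ (dz^i{}_j)z^k{}_j&=tq^{-1}z^k{}_j\,dz^i{}_j+(t-1)z^i{}_j\,dz^k{}_j+\sigma z^i{}_jz^k{}_jT &&(i<k),\\ (dz^i{}_j)z^k{}_l&=t z^k{}_l\,dz^i{}_j+(t-1)z^i{}_j\,dz^k{}_l+\sigma z^i{}_jz^k{}_lT-\beta(z^i{}_jz^k{}_l-q z^i{}_lz^k{}_j)T &&(i<k,\ j<l),\\ (dz^i{}_j)z^k{}_l&=t z^k{}_l\,dz^i{}_j+(t-1)z^i{}_j\,dz^k{}_l+\sigma z^i{}_jz^k{}_lT-t\lambda z^k{}_j\,dz^i{}_l+q\beta(z^i{}_lz^k{}_j-q z^i{}_jz^k{}_l)T &&(i<k,\ j>l), \end{aligned}$$ with $\sigma=\frac{(q^2-t)(t-1)}{q^4(q^2+1)(t-1)-q^2+t}$,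 $\beta=\frac{t(q^2-1)(t-1)}{q^4(q^2+1)(t-1)-q^2+t}$; and a calculus $\Gamma_2(t)$, where $(q^6+q^2+1)t-(q^4+q^2+1)\ne0$ is required, if $$\begin{aligned} (dz^i{}_j)z^i{}_j&=(tq^2+t-1)z^i{}_j\,dz^i{}_j+\hat\sigma z^i{}_jz^i{}_jT,\\ (dz^i{}_j)z^i{}_l&=tq z^i{}_l\,dz^i{}_j+(tq^2-1)z^i{}_j\,dz^i{}_l+\hat\sigma z^i{}_jz^i{}_lT &&(j<l),\\ (dz^i{}_j)z^k{}_j&=tq z^k{}_j\,dz^i{}_j+(tq^2-1)z^i{}_j\,dz^k{}_j+\hat\sigma z^i{}_jz^k{}_jT &&(i<k),\\ (dz^i{}_j)z^k{}_l&=t z^k{}_l\,dz^i{}_j+(t-1)z^i{}_j\,dz^k{}_l+\hat\sigma z^i{}_jz^k{}_lT+t\lambda(z^i{}_l\,dz^k{}_j+z^k{}_j\,dz^i{}_l)\\ &\quad+t\lambda^2z^i{}_j\,dz^k{}_l-q^{-2}\hat\beta(z^i{}_jz^k{}_l-q z^i{}_lz^k{}_j)T &&(i<k,\ j<l),\\ (dz^i{}_j)z^k{}_l&=t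 z^k{}_l\,dz^i{}_j+(t-1)z^i{}_j\,dz^k{}_l+\hat\sigma z^i{}_jz^k{}_lT+t\lambda z^i{}_l\,dz^k{}_j+q^{-1}\hat\beta(z^i{}_lz^k{}_j-q z^i{}_jz^k{}_l)T &&(i<k,\ j>l), \end{aligned}$$ with $\hat\sigma=-\frac{(q^2t-1)(t-1)}{q^4(q^2t-1)+(q^2+1)(t-1)}$, $\hat\beta=-\frac{t(q^2-1)(t-1)}{q^4(q^2t-1)+(q^2+1)(t-1)}$. Then in every calculus $\Gamma_\nu(t)$, $\nu\in\{1,2\}$, the differential is an inner derivation: $\mathcal N\neq0$ and $$da=\frac1{\mathcal N}\,[\mathrm{Tr}_q\theta,a]=\frac1{\mathcal N}\bigl((\mathrm{Tr}_q\theta)a-a\,\mathrm{Tr}_q\theta\bigr)\quad\text{for all }a\in\mathcal A,$$ where $$\mathcal N=\begin{cases}q^{-2}\bigl(q^4(q^2+1)(t-1)-q^2+t\bigr)&\nu=1,\\ q^4(q^2t-1)+(q^2+1)(t-1)&\nu=2.\end{cases}$$ -/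

import Mathlib

open scoped TensorProduct RightActions

noncomputable section

/-! ### First order differential calculi -/

/-- A first order differential calculus over a complex algebra `A`, with values in the
`A`-bimodule `Γ` (left action `a • ω`, right action `ω <• a`). -/
structure FirstOrderCalculus (A : Type*) [Ring A] [Algebra ℂ A] (Γ : Type*) [AddCommGroup Γ]
    [Module ℂ Γ] [Module A Γ] [Module Aᵐᵒᵖ Γ] where
  /-- the differential -/
  d : A →ₗ[ℂ] Γ
  leibniz : ∀ a b : A, d (a * b) = d a <• b + a • d b
  span_range : Submodule.span A (Set.range d) = ⊤

section Bicovariance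

variable {A : Type*} [Ring A] [Algebra ℂ A] {Γ : Type*} [AddCommGroup Γ] [Module ℂ Γ]
  [Module A Γ] [IsScalarTower ℂ A Γ]

/-- The left action of `A` on `Γ` as a bilinear map. -/
def leftAct (A : Type*) [Ring A] [Algebra ℂ A] (Γ : Type*) [AddCommGroup Γ] [Module ℂ Γ]
    [Module A Γ] [IsScalarTower ℂ A Γ] : A →ₗ[ℂ] Γ →ₗ[ℂ] Γ :=
  (Algebra.lsmul ℂ ℂ Γ).toLinearMap

/-- The left action of `A ⊗ A` on `A ⊗ Γ`: `(a ⊗ b) (c ⊗ ω) = a c ⊗ b ω`. -/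
def actAΓ : A ⊗[ℂ] A →ₗ[ℂ] A ⊗[ℂ] Γ →ₗ[ℂ] A ⊗[ℂ] Γ :=
  TensorProduct.map₂ (LinearMap.mul ℂ A) (leftAct A Γ)

/-- The left action of `A ⊗ A` on `Γ ⊗ A`: `(a ⊗ b) (ω ⊗ c) = a ω ⊗ b c`. -/
def actΓA : A ⊗[ℂ] A →ₗ[ℂ] Γ ⊗[ℂ] A →ₗ[ℂ] Γ ⊗[ℂ] A :=
  TensorProduct.map₂ (leftAct A Γ) (LinearMap.mul ℂ A)

end Bicovariance

/-- A first order differential calculus over a bialgebra is bicovariant if there are linear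
coactions `Δ_L`, `Δ_R` with `Δ_L (a db) = Δ(a) (id ⊗ d) Δ(b)` and
`Δ_R (a db) = Δ(a) (d ⊗ id) Δ(b)`. -/
def FirstOrderCalculus.IsBicovariant {A : Type*} [Ring A] [Bialgebra ℂ A] {Γ : Type*}
    [AddCommGroup Γ] [Module ℂ Γ] [Module A Γ] [Module Aᵐᵒᵖ Γ] [IsScalarTower ℂ A Γ]
    (C : FirstOrderCalculus A Γ) : Prop :=
  (∃ ΔL : Γ →ₗ[ℂ] A ⊗[ℂ] Γ, ∀ a b : A, ΔL (a • C.d b) =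
    actAΓ (Coalgebra.comul (R := ℂ) a) (C.d.lTensor A (Coalgebra.comul (R := ℂ) b))) ∧
  (∃ ΔR : Γ →ₗ[ℂ] Γ ⊗[ℂ] A, ∀ a b : A, ΔR (a • C.d b) =
    actΓA (Coalgebra.comul (R := ℂ) a) (C.d.rTensor A (Coalgebra.comul (R := ℂ) b)))

/-! ### The quantum group `GL_q(3, ℂ)` -/

namespace GLq3

/-- Generators: the matrix entries `zⁱⱼ` (indices `0, 1, 2`) and the inverse of the quantum
determinant. -/
inductive Gen
  | z (i j : Fin 3)
  | detInv

/-- The generator `zⁱⱼ` in the free algebra. -/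
def fz (i j : Fin 3) : FreeAlgebra ℂ Gen := FreeAlgebra.ι ℂ (Gen.z i j)

/-- The generator `𝒟⁻¹` in the free algebra. -/
def fdetInv : FreeAlgebra ℂ Gen := FreeAlgebra.ι ℂ Gen.detInv

/-- The quantum determinant as an expression in nine elements of an algebra. -/
def qdet {B : Type*} [Ring B] [Algebra ℂ B] (q : ℂ) (x : Fin 3 → Fin 3 → B) : B :=
  x 0 0 * x 1 1 * x 2 2 + q ^ 2 • (x 0 1 * x 1 2 * x 2 0) + q ^ 2 • (x 0 2 * x 1 0 * x 2 1)
    - q • (x 0 0 * x 1 2 * x 2 1) - q ^ 3 • (x 0 2 * x 1 1 * x 2 0)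
    - q • (x 0 1 * x 1 0 * x 2 2)

/-- The defining relations. -/
inductive Rel (q : ℂ) : FreeAlgebra ℂ Gen → FreeAlgebra ℂ Gen → Prop
  | row (i j k : Fin 3) (h : j < k) : Rel q (fz i j * fz i k) (q • (fz i k * fz i j))
  | col (i k j : Fin 3) (h : i < k) : Rel q (fz i j * fz k j) (q • (fz k j * fz i j))
  | anti (i k j l : Fin 3) (h : i < k) (h' : l < j) : Rel q (fz i j * fz k l) (fz k l * fz i j)
  | diag (i k j l : Fin 3) (h : i < k) (h' : j < l) :
      Rel q (fz i j * fz k l) (fz k l * fz i j + (q - q⁻¹) • (fz k j * fz i l))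
  | det_mul : Rel q (qdet q fz * fdetInv) 1
  | mul_det : Rel q (fdetInv * qdet q fz) 1

end GLq3

/-- The algebra `Fun_q(GL(3, ℂ))`. -/
def GLq3 (q : ℂ) : Type := RingQuot (GLq3.Rel q)

namespace GLq3

instance (q : ℂ) : Ring (GLq3 q) := inferInstanceAs (Ring (RingQuot (GLq3.Rel q)))
instance (q : ℂ) : Algebra ℂ (GLq3 q) := inferInstanceAs (Algebra ℂ (RingQuot (GLq3.Rel q)))

/-- The quotient map. -/
def mk (q : ℂ) : FreeAlgebra ℂ Gen →ₐ[ℂ] GLq3 q := RingQuot.mkAlgHom ℂ (Rel q)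

/-- The generator `zⁱⱼ` of `Fun_q(GL(3, ℂ))`. -/
def z (q : ℂ) (i j : Fin 3) : GLq3 q := mk q (fz i j)

/-- The inverse `𝒟⁻¹` of the quantum determinant. -/
def detInv (q : ℂ) : GLq3 q := mk q fdetInv

/-- The quantum determinant `𝒟`. -/
def det (q : ℂ) : GLq3 q := qdet q (z q)

lemma map_qdet {B C : Type*} [Ring B] [Algebra ℂ B] [Ring C] [Algebra ℂ C] (q : ℂ)
    (f : B →ₐ[ℂ] C) (x : Fin 3 → Fin 3 → B) :
    f (qdet q x) = qdet q (fun i j => f (x i j)) := by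
  simp [qdet]

section relations

variable (q : ℂ)

lemma mk_rel {x y : FreeAlgebra ℂ Gen} (h : Rel q x y) : mk q x = mk q y :=
  RingQuot.mkAlgHom_rel ℂ h

lemma z_row (i j k : Fin 3) (h : j < k) : z q i j * z q i k = q • (z q i k * z q i j) := by
  simpa [z] using mk_rel q (Rel.row i j k h)

lemma z_col (i k j : Fin 3) (h : i < k) : z q i j * z q k j = q • (z q k j * z q i j) := by
  simpa [z] using mk_rel q (Rel.col i k j h)

lemma z_anti (i k j l : Fin 3) (h : i < k) (h' : l < j) :
    z q i j * z q k l = z q k l * z q i j := by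
  simpa [z] using mk_rel q (Rel.anti i k j l h h')

lemma z_diag (i k j l : Fin 3) (h : i < k) (h' : j < l) :
    z q i j * z q k l = z q k l * z q i j + (q - q⁻¹) • (z q k j * z q i l) := by
  have := mk_rel q (Rel.diag i k j l h h')
  rwa [map_add, map_smul, map_mul, map_mul, map_mul] at this

lemma det_mul_detInv : det q * detInv q = 1 := by
  have := mk_rel q Rel.det_mul
  rwa [map_mul, map_one, map_qdet] at this

lemma detInv_mul_det : detInv q * det q = 1 := by
  have := mk_rel q Rel.mul_det
  rwa [map_mul, map_one, map_qdet] at this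

end relations

/-- Nine elements and one further element satisfying the defining relations induce an algebra
homomorphism out of `Fun_q(GL(3, ℂ))`. -/
def lift {B : Type*} [Ring B] [Algebra ℂ B] (q : ℂ) (x : Fin 3 → Fin 3 → B) (y : B)
    (hrow : ∀ i j k, j < k → x i j * x i k = q • (x i k * x i j))
    (hcol : ∀ i k j, i < k → x i j * x k j = q • (x k j * x i j))
    (hanti : ∀ i k j l, i < k → l < j → x i j * x k l = x k l * x i j)
    (hdiag : ∀ i k j l, i < k → j < l →
      x i j * x k l = x k l * x i j + (q - q⁻¹) • (x k j * x i l))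
    (h1 : qdet q x * y = 1) (h2 : y * qdet q x = 1) : GLq3 q →ₐ[ℂ] B :=
  RingQuot.liftAlgHom ℂ ⟨FreeAlgebra.lift ℂ (fun g => match g with
    | Gen.z i j => x i j
    | Gen.detInv => y), by
      intro a b h
      cases h with
      | row i j k h => simpa [fz] using hrow i j k h
      | col i j k h => simpa [fz] using hcol i j k h
      | anti i k j l h h' => simpa [fz] using hanti i k j l h h'
      | diag i k j l h h' =>
        have := hdiag i k j l h h'
        rw [map_add, map_smul]
        simpa [fz] using this
      | det_mul => simpa [map_qdet, fz, fdetInv] using h1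
      | mul_det => simpa [map_qdet, fz, fdetInv] using h2⟩

section lift

variable {B : Type*} [Ring B] [Algebra ℂ B] (q : ℂ) (x : Fin 3 → Fin 3 → B) (y : B)
    (hrow : ∀ i j k, j < k → x i j * x i k = q • (x i k * x i j))
    (hcol : ∀ i k j, i < k → x i j * x k j = q • (x k j * x i j))
    (hanti : ∀ i k j l, i < k → l < j → x i j * x k l = x k l * x i j)
    (hdiag : ∀ i k j l, i < k → j < l →
      x i j * x k l = x k l * x i j + (q - q⁻¹) • (x k j * x i l))
    (h1 : qdet q x * y = 1) (h2 : y * qdet q x = 1)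

lemma lift_z (i j : Fin 3) : lift q x y hrow hcol hanti hdiag h1 h2 (z q i j) = x i j :=
  (RingQuot.liftAlgHom_mkAlgHom_apply ℂ _ _ _).trans (by simp [fz])

lemma lift_detInv : lift q x y hrow hcol hanti hdiag h1 h2 (detInv q) = y :=
  (RingQuot.liftAlgHom_mkAlgHom_apply ℂ _ _ _).trans (by simp [fdetInv])

end lift

lemma algHom_ext {B : Type*} [Ring B] [Algebra ℂ B] {q : ℂ} {f g : GLq3 q →ₐ[ℂ] B}
    (hz : ∀ i j, f (z q i j) = g (z q i j)) (hd : f (detInv q) = g (detInv q)) : f = g := by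
  refine RingQuot.ringQuot_ext' ℂ f g ?_
  apply FreeAlgebra.hom_ext
  funext x
  cases x with
  | z i j => exact hz i j
  | detInv => exact hd

lemma no_anti (q : ℂ) (i k j l : Fin 3) (h : i < k) (h' : l < j) :
    z q k l * z q i j = (1 : ℂ) • (z q i j * z q k l) := by
  rw [one_smul, z_anti q i k j l h h']

lemma no_diag (q : ℂ) (i k j l : Fin 3) (h : i < k) (h' : j < l) :
    z q k l * z q i j = z q i j * z q k l - (q - q⁻¹) • (z q i l * z q k j) := by
  rw [z_diag q i k j l h h', z_anti q i k l j h h']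
  abel

/-- The counit: `ε(zⁱⱼ) = δⁱⱼ`, `ε(𝒟⁻¹) = 1`. -/
def counitHom (q : ℂ) : GLq3 q →ₐ[ℂ] ℂ :=
  lift q (fun i j => if i = j then 1 else 0) 1
    (by intro i j k h; have := h.ne; have := h.ne'; simp; grind)
    (by intro i j k h; have := h.ne; have := h.ne'; simp; grind)
    (by intro i k j l h h'; simp; grind)
    (by intro i k j l h h'; simp; grind)
    (by simp [qdet]) (by simp [qdet])

lemma counitHom_z (q : ℂ) (i j : Fin 3) : counitHom q (z q i j) = if i = j then 1 else 0 :=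
  lift_z ..

lemma counitHom_detInv (q : ℂ) : counitHom q (detInv q) = 1 :=
  lift_detInv ..

section comul

variable (q : ℂ) [NeZero q]

lemma no_row (i j k : Fin 3) (h : j < k) : z q i k * z q i j = q⁻¹ • (z q i j * z q i k) := by
  rw [z_row q i j k h, smul_smul, inv_mul_cancel₀ (NeZero.ne q), one_smul]

lemma no_col (i k j : Fin 3) (h : i < k) : z q k j * z q i j = q⁻¹ • (z q i j * z q k j) := by
  rw [z_col q i k j h, smul_smul, inv_mul_cancel₀ (NeZero.ne q), one_smul]

lemma no_row' (i j k : Fin 3) (h : j < k) (x : GLq3 q) :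
    z q i k * (z q i j * x) = q⁻¹ • (z q i j * (z q i k * x)) := by
  rw [← mul_assoc, no_row q i j k h, smul_mul_assoc, mul_assoc]

lemma no_col' (i k j : Fin 3) (h : i < k) (x : GLq3 q) :
    z q k j * (z q i j * x) = q⁻¹ • (z q i j * (z q k j * x)) := by
  rw [← mul_assoc, no_col q i k j h, smul_mul_assoc, mul_assoc]

lemma no_anti' (i k j l : Fin 3) (h : i < k) (h' : l < j) (x : GLq3 q) :
    z q k l * (z q i j * x) = (1 : ℂ) • (z q i j * (z q k l * x)) := by
  rw [← mul_assoc, no_anti q i k j l h h', smul_mul_assoc, mul_assoc]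

lemma no_diag' (i k j l : Fin 3) (h : i < k) (h' : j < l) (x : GLq3 q) :
    z q k l * (z q i j * x) =
      z q i j * (z q k l * x) - (q - q⁻¹) • (z q i l * (z q k j * x)) := by
  rw [← mul_assoc, no_diag q i k j l h h', sub_mul, smul_mul_assoc, mul_assoc, mul_assoc]

/-- `∑ₖ zⁱₖ ⊗ zᵏⱼ` -/
def zz (i j : Fin 3) : GLq3 q ⊗[ℂ] GLq3 q := ∑ k, z q i k ⊗ₜ[ℂ] z q k j

lemma zz_row (i j k : Fin 3) (h : j < k) : zz q i j * zz q i k = q • (zz q i k * zz q i j) := by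
  have hq : q ≠ 0 := NeZero.ne q
  simp only [zz, Fin.sum_univ_three, add_mul, mul_add, Algebra.TensorProduct.tmul_mul_tmul,
    no_row q i 0 1 (by decide), no_row q i 0 2 (by decide), no_row q i 1 2 (by decide),
    no_row q _ j k h, no_anti q 0 1 k j (by decide) h, no_anti q 0 2 k j (by decide) h,
    no_anti q 1 2 k j (by decide) h, no_diag q 0 1 j k (by decide) h,
    no_diag q 0 2 j k (by decide) h, no_diag q 1 2 j k (by decide) h,
    TensorProduct.tmul_smul, TensorProduct.tmul_sub, ← TensorProduct.smul_tmul']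
  match_scalars <;> field_simp <;> ring

lemma zz_col (i k j : Fin 3) (h : i < k) : zz q i j * zz q k j = q • (zz q k j * zz q i j) := by
  have hq : q ≠ 0 := NeZero.ne q
  simp only [zz, Fin.sum_univ_three, add_mul, mul_add, Algebra.TensorProduct.tmul_mul_tmul,
    no_col q 0 1 j (by decide), no_col q 0 2 j (by decide), no_col q 1 2 j (by decide),
    no_col q i k _ h, no_anti q i k 1 0 h (by decide), no_anti q i k 2 0 h (by decide),
    no_anti q i k 2 1 h (by decide), no_diag q i k 0 1 h (by decide),
    no_diag q i k 0 2 h (by decide), no_diag q i k 1 2 h (by decide),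
    TensorProduct.tmul_smul, TensorProduct.sub_tmul, ← TensorProduct.smul_tmul']
  match_scalars <;> field_simp <;> ring

lemma zz_anti (i k j l : Fin 3) (h : i < k) (h' : l < j) :
    zz q i j * zz q k l = zz q k l * zz q i j := by
  have hq : q ≠ 0 := NeZero.ne q
  simp only [zz, Fin.sum_univ_three, add_mul, mul_add, Algebra.TensorProduct.tmul_mul_tmul,
    no_col q i k _ h, no_row q _ l j h',
    no_anti q i k 1 0 h (by decide), no_anti q i k 2 0 h (by decide),
    no_anti q i k 2 1 h (by decide), no_diag q i k 0 1 h (by decide),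
    no_diag q i k 0 2 h (by decide), no_diag q i k 1 2 h (by decide),
    no_anti q 0 1 j l (by decide) h', no_anti q 0 2 j l (by decide) h',
    no_anti q 1 2 j l (by decide) h', no_diag q 0 1 l j (by decide) h',
    no_diag q 0 2 l j (by decide) h', no_diag q 1 2 l j (by decide) h',
    TensorProduct.tmul_smul, TensorProduct.sub_tmul, TensorProduct.tmul_sub,
    ← TensorProduct.smul_tmul']
  match_scalars <;> field_simp <;> ring

lemma zz_diag (i k j l : Fin 3) (h : i < k) (h' : j < l) :
    zz q i j * zz q k l = zz q k l * zz q i j + (q - q⁻¹) • (zz q k j * zz q i l) := by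
  have hq : q ≠ 0 := NeZero.ne q
  simp only [zz, Fin.sum_univ_three, add_mul, mul_add, Algebra.TensorProduct.tmul_mul_tmul,
    no_col q i k _ h, no_row q _ j l h',
    no_anti q i k 1 0 h (by decide), no_anti q i k 2 0 h (by decide),
    no_anti q i k 2 1 h (by decide), no_diag q i k 0 1 h (by decide),
    no_diag q i k 0 2 h (by decide), no_diag q i k 1 2 h (by decide),
    no_anti q 0 1 l j (by decide) h', no_anti q 0 2 l j (by decide) h',
    no_anti q 1 2 l j (by decide) h', no_diag q 0 1 j l (by decide) h',
    no_diag q 0 2 j l (by decide) h', no_diag q 1 2 j l (by decide) h',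
    TensorProduct.tmul_smul, TensorProduct.sub_tmul, TensorProduct.tmul_sub,
    ← TensorProduct.smul_tmul']
  match_scalars <;> field_simp <;> ring

/-- The row-expanded quantum minor `∑_σ (-q)^ℓ(σ) zᵃ_σ(1) zᵇ_σ(2) zᶜ_σ(3)`. -/
def minor (a b c : Fin 3) : GLq3 q := qdet q ![z q a, z q b, z q c]

lemma minor_eq (a b c : Fin 3) : minor q a b c =
    (if a = 0 ∧ b = 1 ∧ c = 2 then 1 else if a = 0 ∧ b = 2 ∧ c = 1 then -q
      else if a = 1 ∧ b = 0 ∧ c = 2 then -q else if a = 1 ∧ b = 2 ∧ c = 0 then q ^ 2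
      else if a = 2 ∧ b = 0 ∧ c = 1 then q ^ 2 else if a = 2 ∧ b = 1 ∧ c = 0 then -q ^ 3
      else 0) • det q := by
  have hq : q ≠ 0 := NeZero.ne q
  fin_cases a <;> fin_cases b <;> fin_cases c <;>
  · simp only [minor, det, qdet, Fin.zero_eta, Fin.mk_one, Fin.reduceFinMk, Matrix.cons_val,
      mul_assoc, Fin.reduceEq, and_true, and_false, if_true, if_false]
    simp (disch := decide) only [no_row q, no_col q, no_anti q, no_diag q, no_row' q, no_col' q,
      no_anti' q, no_diag' q, mul_sub, sub_mul, smul_sub, smul_smul, mul_assoc, mul_smul_comm,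
      smul_mul_assoc]
    match_scalars <;> field_simp <;> ring

lemma qdet_zz : qdet q (zz q) = det q ⊗ₜ[ℂ] det q := by
  have key : qdet q (zz q) = ∑ a, ∑ b, ∑ c, (z q 0 a * z q 1 b * z q 2 c) ⊗ₜ[ℂ] minor q a b c := by
    simp only [qdet, zz, minor, Fin.sum_univ_three, add_mul, mul_add,
      Algebra.TensorProduct.tmul_mul_tmul, Matrix.cons_val, TensorProduct.tmul_add,
      TensorProduct.tmul_sub, TensorProduct.tmul_smul, smul_add]
    abel
  rw [key]
  simp only [minor_eq, Fin.sum_univ_three]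
  simp only [Fin.reduceEq, and_true, and_false, if_true, if_false,
    zero_smul, TensorProduct.tmul_zero, add_zero, zero_add, one_smul, TensorProduct.tmul_smul]
  conv_rhs => enter [2]; rw [det, qdet]
  simp only [TensorProduct.add_tmul, TensorProduct.sub_tmul, ← TensorProduct.smul_tmul']
  module

/-- The coproduct: `Δ(zⁱⱼ) = ∑ₖ zⁱₖ ⊗ zᵏⱼ`, `Δ(𝒟⁻¹) = 𝒟⁻¹ ⊗ 𝒟⁻¹`. -/
def comulHom : GLq3 q →ₐ[ℂ] GLq3 q ⊗[ℂ] GLq3 q :=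
  lift q (zz q) (detInv q ⊗ₜ[ℂ] detInv q) (zz_row q) (zz_col q) (zz_anti q) (zz_diag q)
    (by rw [qdet_zz, Algebra.TensorProduct.tmul_mul_tmul, det_mul_detInv]; rfl)
    (by rw [qdet_zz, Algebra.TensorProduct.tmul_mul_tmul, detInv_mul_det]; rfl)

lemma comulHom_z (i j : Fin 3) : comulHom q (z q i j) = ∑ k, z q i k ⊗ₜ[ℂ] z q k j :=
  lift_z ..

lemma comulHom_detInv : comulHom q (detInv q) = detInv q ⊗ₜ[ℂ] detInv q :=
  lift_detInv ..

instance : Bialgebra ℂ (GLq3 q) :=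
  Bialgebra.ofAlgHom (comulHom q) (counitHom q)
    (by
      apply algHom_ext
      · intro i j
        simp [comulHom_z, TensorProduct.sum_tmul, TensorProduct.tmul_sum]
        exact Finset.sum_comm
      · simp [comulHom_detInv])
    (by
      apply algHom_ext
      · intro i j
        simp [comulHom_z, counitHom_z, ite_smul, TensorProduct.ite_tmul]
      · simp [comulHom_detInv, counitHom_detInv])
    (by
      apply algHom_ext
      · intro i j
        simp [comulHom_z, counitHom_z, TensorProduct.tmul_ite]
      · simp [comulHom_detInv, counitHom_detInv])

end comul

/-- The antipode on generators: the matrix `S(Z)`, with `S(zⁱⱼ) = antipodeZ q i j`. -/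
def antipodeZ (q : ℂ) (i j : Fin 3) : GLq3 q :=
  detInv q * (!![
    z q 1 1 * z q 2 2 - q • (z q 1 2 * z q 2 1),
      -(q⁻¹ • (z q 0 1 * z q 2 2)) + z q 0 2 * z q 2 1,
      (q ^ 2)⁻¹ • (z q 0 1 * z q 1 2) - q⁻¹ • (z q 0 2 * z q 1 1);
    -(q • (z q 1 0 * z q 2 2)) + q ^ 2 • (z q 1 2 * z q 2 0),
      z q 0 0 * z q 2 2 - q • (z q 0 2 * z q 2 0),
      -(q⁻¹ • (z q 0 0 * z q 1 2)) + z q 0 2 * z q 1 0;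
    q ^ 2 • (z q 1 0 * z q 2 1) - q ^ 3 • (z q 1 1 * z q 2 0),
      -(q • (z q 0 0 * z q 2 1)) + q ^ 2 • (z q 0 1 * z q 2 0),
      z q 0 0 * z q 1 1 - q • (z q 0 1 * z q 1 0)] i j)

/-! ### The calculi `Γ₁(t)` and `Γ₂(t)` -/

section calculi

variable {q : ℂ} {Γ : Type*} [AddCommGroup Γ] [Module ℂ Γ] [Module (GLq3 q) Γ]
  [Module (GLq3 q)ᵐᵒᵖ Γ]

/-- The left-invariant Maurer-Cartan forms `θⁱⱼ = ∑ₖ S(zⁱₖ) dzᵏⱼ`. -/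
def theta (C : FirstOrderCalculus (GLq3 q) Γ) (i j : Fin 3) : Γ :=
  ∑ k, antipodeZ q i k • C.d (z q k j)

/-- `Tr_q θ = q⁴ θ¹₁ + q² θ²₂ + θ³₃`. -/
def trTheta (C : FirstOrderCalculus (GLq3 q) Γ) : Γ :=
  q ^ 4 • theta C 0 0 + q ^ 2 • theta C 1 1 + theta C 2 2

/-- The coefficient `σ`. -/
def sigma₁ (q t : ℂ) : ℂ :=
  (q ^ 2 - t) * (t - 1) / (q ^ 4 * (q ^ 2 + 1) * (t - 1) - q ^ 2 + t)

/-- The coefficient `β`. -/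
def beta₁ (q t : ℂ) : ℂ :=
  t * (q ^ 2 - 1) * (t - 1) / (q ^ 4 * (q ^ 2 + 1) * (t - 1) - q ^ 2 + t)

/-- The coefficient `σ̂`. -/
def sigma₂ (q t : ℂ) : ℂ :=
  -((q ^ 2 * t - 1) * (t - 1) / (q ^ 4 * (q ^ 2 * t - 1) + (q ^ 2 + 1) * (t - 1)))

/-- The coefficient `β̂`. -/
def beta₂ (q t : ℂ) : ℂ :=
  -(t * (q ^ 2 - 1) * (t - 1) / (q ^ 4 * (q ^ 2 * t - 1) + (q ^ 2 + 1) * (t - 1)))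

/-- `(Γ, d)` is a calculus `Γ₁(t)`: a bicovariant first order differential calculus generated
by the `dzⁱⱼ` as a left module, with the commutation relations of the first family. -/
structure IsGamma₁ [NeZero q] [IsScalarTower ℂ (GLq3 q) Γ] (t : ℂ)
    (C : FirstOrderCalculus (GLq3 q) Γ) : Prop where
  bicovariant : C.IsBicovariant
  span_dz : Submodule.span (GLq3 q) (Set.range fun p : Fin 3 × Fin 3 => C.d (z q p.1 p.2)) = ⊤
  comm_same (i j : Fin 3) :
    C.d (z q i j) <• z q i j = (t / q ^ 2 + t - 1) • (z q i j • C.d (z q i j))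
      + sigma₁ q t • ((z q i j * z q i j) • trTheta C)
  comm_row (i j l : Fin 3) : j < l →
    C.d (z q i j) <• z q i l = (t / q) • (z q i l • C.d (z q i j))
      + (t - 1) • (z q i j • C.d (z q i l))
      + sigma₁ q t • ((z q i j * z q i l) • trTheta C)
  comm_col (i k j : Fin 3) : i < k →
    C.d (z q i j) <• z q k j = (t / q) • (z q k j • C.d (z q i j))
      + (t - 1) • (z q i j • C.d (z q k j))
      + sigma₁ q t • ((z q i j * z q k j) • trTheta C)
  comm_diag (i k j l : Fin 3) : i < k → j < l →
    C.d (z q i j) <• z q k l = t • (z q k l • C.d (z q i j))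
      + (t - 1) • (z q i j • C.d (z q k l))
      + sigma₁ q t • ((z q i j * z q k l) • trTheta C)
      - beta₁ q t • ((z q i j * z q k l - q • (z q i l * z q k j)) • trTheta C)
  comm_anti (i k j l : Fin 3) : i < k → l < j →
    C.d (z q i j) <• z q k l = t • (z q k l • C.d (z q i j))
      + (t - 1) • (z q i j • C.d (z q k l))
      + sigma₁ q t • ((z q i j * z q k l) • trTheta C)
      - (t * (q - 1 / q)) • (z q k j • C.d (z q i l))
      + (q * beta₁ q t) • ((z q i l * z q k j - q • (z q i j * z q k l)) • trTheta C)

/-- `(Γ, d)` is a calculus `Γ₂(t)`: a bicovariant first order differential calculus generated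
by the `dzⁱⱼ` as a left module, with the commutation relations of the second family. -/
structure IsGamma₂ [NeZero q] [IsScalarTower ℂ (GLq3 q) Γ] (t : ℂ)
    (C : FirstOrderCalculus (GLq3 q) Γ) : Prop where
  bicovariant : C.IsBicovariant
  span_dz : Submodule.span (GLq3 q) (Set.range fun p : Fin 3 × Fin 3 => C.d (z q p.1 p.2)) = ⊤
  comm_same (i j : Fin 3) :
    C.d (z q i j) <• z q i j = (t * q ^ 2 + t - 1) • (z q i j • C.d (z q i j))
      + sigma₂ q t • ((z q i j * z q i j) • trTheta C)
  comm_row (i j l : Fin 3) : j < l →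
    C.d (z q i j) <• z q i l = (t * q) • (z q i l • C.d (z q i j))
      + (t * q ^ 2 - 1) • (z q i j • C.d (z q i l))
      + sigma₂ q t • ((z q i j * z q i l) • trTheta C)
  comm_col (i k j : Fin 3) : i < k →
    C.d (z q i j) <• z q k j = (t * q) • (z q k j • C.d (z q i j))
      + (t * q ^ 2 - 1) • (z q i j • C.d (z q k j))
      + sigma₂ q t • ((z q i j * z q k j) • trTheta C)
  comm_diag (i k j l : Fin 3) : i < k → j < l →
    C.d (z q i j) <• z q k l = t • (z q k l • C.d (z q i j))
      + (t - 1) • (z q i j • C.d (z q k l))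
      + sigma₂ q t • ((z q i j * z q k l) • trTheta C)
      + (t * (q - 1 / q)) • (z q i l • C.d (z q k j) + z q k j • C.d (z q i l))
      + (t * (q - 1 / q) ^ 2) • (z q i j • C.d (z q k l))
      - (1 / q ^ 2 * beta₂ q t) •
          ((z q i j * z q k l - q • (z q i l * z q k j)) • trTheta C)
  comm_anti (i k j l : Fin 3) : i < k → l < j →
    C.d (z q i j) <• z q k l = t • (z q k l • C.d (z q i j))
      + (t - 1) • (z q i j • C.d (z q k l))
      + sigma₂ q t • ((z q i j * z q k l) • trTheta C)
      + (t * (q - 1 / q)) • (z q i l • C.d (z q k j))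
      + (1 / q * beta₂ q t) •
          ((z q i l * z q k j - q • (z q i j * z q k l)) • trTheta C)

end calculi

/-- The normalization `𝒩` for `Γ₁(t)`. -/
def norm₁ (q t : ℂ) : ℂ := 1 / q ^ 2 * (q ^ 4 * (q ^ 2 + 1) * (t - 1) - q ^ 2 + t)

/-- The normalization `𝒩` for `Γ₂(t)`. -/
def norm₂ (q t : ℂ) : ℂ := q ^ 4 * (q ^ 2 * t - 1) + (q ^ 2 + 1) * (t - 1)

end GLq3

end

/-! Let `Z₁Z₂` be the tensor with entries `zˡ_b zⁱ_j`, and put `λ = q - q⁻¹`. Let `R` and `R'` be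
the Hecke braidings of the row pair `(l, i)` and of the column pair `(b, j)`. They commute, both
satisfy `X² = λX + 1`, and the quantum matrix relations say `R(Z₁Z₂) = R'(Z₁Z₂)`
(`braidRow_zTensor`).

All five families of commutation relations are entries of one identity, `d(Z₁Z₂) = t((R - μ)(R' - μ)
+ 1) Z₁dZ₂ + s Z₁Z₂T + u R(Z₁Z₂T)`, with `μ = λ` for `Γ₁(t)`, where `R - λ = R⁻¹`, and `μ = 0` for
`Γ₂(t)`. The calculus prescribes only the entries with ordered indices. The others follow because
`R` and `R'` agree on both sides (`eq_of_braidRow_eq_braidCol`, `IsGamma₁.d_zTensor`,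
`IsGamma₂.d_zTensor`).

Now multiply by `S(Z₁)` on the left and take the trace over the first column index with weights `q⁴,
q², 1`. Then `(dZ₁)Z₂` becomes `T zⁱⱼ`. On `Z₁dZ₂`, the identity gives `(q⁴ + q² + 1) dzⁱⱼ`, a
single braiding gives `q⁵ dzⁱⱼ`, and `RR'` gives `zⁱⱼ T + λq⁵ dzⁱⱼ`. The coefficients of `zⁱⱼ T` add
up to `1`, which leaves `T zⁱⱼ - zⁱⱼ T = 𝒩 dzⁱⱼ` (`trTheta_commutator_z`). The condition imposed on
`t` says exactly that `𝒩 ≠ 0`.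

Finally, `[T, ·]` and `𝒩 d` are derivations, so agreement on the `zⁱⱼ` extends to products, sums and
the inverse determinant (`commutator_eq_smul_d`). -/

namespace GLq3

/-! ### Centrality of the quantum determinant and the inverse matrix -/

section antipode

variable (q : ℂ) [NeZero q]

/-- Rewriting both sides into lexicographic order of (row, column) makes them comparable coefficient
by coefficient. Centrality passes to `detInv`, so that the inverse determinant can be pulled out of
`z_mul_antipodeZ`, leaving quantum cofactor expansions. -/
lemma z_mul_det (i j : Fin 3) : z q i j * det q = det q * z q i j := by
  have hq : q ≠ 0 := NeZero.ne q
  fin_cases i <;> fin_cases j <;>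
  · simp only [det, qdet, Fin.zero_eta, Fin.mk_one, Fin.reduceFinMk, mul_assoc, add_mul, mul_add,
      mul_sub, sub_mul, mul_smul_comm, smul_mul_assoc]
    simp (disch := decide) only [no_row q, no_col q, no_anti q, no_diag q, no_row' q, no_col' q,
      no_anti' q, no_diag' q, mul_sub, sub_mul, smul_sub, smul_smul, mul_assoc, mul_smul_comm]
    match_scalars <;> field_simp <;> ring

lemma z_mul_detInv (i j : Fin 3) : z q i j * detInv q = detInv q * z q i j := by
  calc z q i j * detInv q = detInv q * (det q * z q i j) * detInv q := by
        rw [← mul_assoc, detInv_mul_det, one_mul]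
    _ = detInv q * z q i j := by
        rw [← z_mul_det, mul_assoc, mul_assoc, det_mul_detInv, mul_one]

lemma antipodeZ_mul_z (i j : Fin 3) :
    ∑ k, antipodeZ q i k * z q k j = if i = j then 1 else 0 := by
  have hq : q ≠ 0 := NeZero.ne q
  simp only [antipodeZ, mul_assoc, ← Finset.mul_sum]
  trans detInv q * (if i = j then det q else 0)
  · congr 1
    fin_cases i <;> fin_cases j <;>
    · simp only [Fin.sum_univ_three, det, qdet, Fin.zero_eta, Fin.mk_one, Fin.reduceFinMk,
        mul_assoc, add_mul, sub_mul, neg_mul, smul_mul_assoc, Matrix.of_apply, Matrix.cons_val,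
        Fin.reduceEq, if_true, if_false]
      simp (disch := decide) only [no_col q, no_anti q, no_diag q, no_col' q,
        no_anti' q, no_diag' q, mul_sub, sub_mul, smul_sub, smul_smul, mul_smul_comm]
      match_scalars <;> field_simp <;> ring
  · split_ifs <;> simp [detInv_mul_det]

lemma z_mul_antipodeZ (i j : Fin 3) :
    ∑ k, z q i k * antipodeZ q k j = if i = j then 1 else 0 := by
  have hq : q ≠ 0 := NeZero.ne q
  simp only [antipodeZ, ← mul_assoc, z_mul_detInv]
  simp only [mul_assoc, ← Finset.mul_sum]
  trans detInv q * (if i = j then det q else 0)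
  · congr 1
    fin_cases i <;> fin_cases j <;>
    · simp only [Fin.sum_univ_three, det, qdet, Fin.zero_eta, Fin.mk_one, Fin.reduceFinMk,
        mul_assoc, mul_add, mul_sub, mul_neg, mul_smul_comm, Matrix.of_apply, Matrix.cons_val,
        Fin.reduceEq, if_true, if_false]
      try simp (disch := decide) only [no_row q, no_anti q, no_diag q, no_row' q,
        no_anti' q, no_diag' q, mul_sub, sub_mul, smul_sub, smul_smul, mul_smul_comm]
      match_scalars <;> field_simp <;> ring
  · split_ifs <;> simp [detInv_mul_det]

end antipode

/-! ### Hecke braidings on four-index tensors -/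

section braiding

variable {M : Type*} [AddCommGroup M] [Module ℂ M]

/-- The Hecke braiding acting on the pair of row indices of a four-index tensor. -/
noncomputable def braidRow (q : ℂ) : Module.End ℂ (Fin 3 → Fin 3 → Fin 3 → Fin 3 → M) where
  toFun f l i b j := (if l = i then q else 1) • f i l b j + (if l < i then q - q⁻¹ else 0) • f l i b j
  map_add' f g := by ext; simp only [Pi.add_apply]; module
  map_smul' c f := by ext; simp only [Pi.smul_apply, RingHom.id_apply]; module

/-- The Hecke braiding acting on the pair of column indices of a four-index tensor. -/
noncomputable def braidCol (q : ℂ) : Module.End ℂ (Fin 3 → Fin 3 → Fin 3 → Fin 3 → M) where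
  toFun f l i b j := (if b = j then q else 1) • f l i j b + (if b < j then q - q⁻¹ else 0) • f l i b j
  map_add' f g := by ext; simp only [Pi.add_apply]; module
  map_smul' c f := by ext; simp only [Pi.smul_apply, RingHom.id_apply]; module

lemma braidRow_apply (q : ℂ) (f : Fin 3 → Fin 3 → Fin 3 → Fin 3 → M) (l i b j : Fin 3) :
    braidRow q f l i b j =
      (if l = i then q else 1) • f i l b j + (if l < i then q - q⁻¹ else 0) • f l i b j := rfl

lemma braidCol_apply (q : ℂ) (f : Fin 3 → Fin 3 → Fin 3 → Fin 3 → M) (l i b j : Fin 3) :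
    braidCol q f l i b j =
      (if b = j then q else 1) • f l i j b + (if b < j then q - q⁻¹ else 0) • f l i b j := rfl

lemma braidRow_braidRow (q : ℂ) [NeZero q] (f : Fin 3 → Fin 3 → Fin 3 → Fin 3 → M) :
    braidRow q (braidRow q f) = (q - q⁻¹) • braidRow q f + f := by
  have hq : q ≠ 0 := NeZero.ne q
  ext l i b j
  simp only [braidRow_apply, Pi.add_apply, Pi.smul_apply]
  rcases lt_trichotomy l i with h | rfl | h
  · simp only [h, h.ne, h.ne', h.not_gt, if_true, if_false]; module
  · simp only [lt_irrefl, if_true, if_false]; match_scalars; field_simp; ring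
  · simp only [h, h.ne, h.ne', h.not_gt, if_true, if_false]; module

lemma braidCol_braidCol (q : ℂ) [NeZero q] (f : Fin 3 → Fin 3 → Fin 3 → Fin 3 → M) :
    braidCol q (braidCol q f) = (q - q⁻¹) • braidCol q f + f := by
  have hq : q ≠ 0 := NeZero.ne q
  ext l i b j
  simp only [braidCol_apply, Pi.add_apply, Pi.smul_apply]
  rcases lt_trichotomy b j with h | rfl | h
  · simp only [h, h.ne, h.ne', h.not_gt, if_true, if_false]; module
  · simp only [lt_irrefl, if_true, if_false]; match_scalars; field_simp; ring
  · simp only [h, h.ne, h.ne', h.not_gt, if_true, if_false]; module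

lemma braidCol_braidRow (q : ℂ) (f : Fin 3 → Fin 3 → Fin 3 → Fin 3 → M) :
    braidCol q (braidRow q f) = braidRow q (braidCol q f) := by
  ext l i b j
  simp only [braidCol_apply, braidRow_apply]
  module

/-- The entries with ordered row indices, and ordered column indices when the rows agree, determine
a tensor on which the two braidings agree. -/
lemma eq_of_braidRow_eq_braidCol {q : ℂ} [NeZero q] {f g : Fin 3 → Fin 3 → Fin 3 → Fin 3 → M}
    (hf : braidRow q f = braidCol q f) (hg : braidRow q g = braidCol q g)
    (hlt : ∀ l i b j, l < i → f l i b j = g l i b j)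
    (heq : ∀ l b j, b ≤ j → f l l b j = g l l b j) : f = g := by
  have hq : q ≠ 0 := NeZero.ne q
  ext l i b j
  rcases lt_trichotomy l i with h | rfl | h
  · exact hlt l i b j h
  · rcases le_or_gt b j with h | h
    · exact heq l b j h
    -- On equal rows the row braiding is multiplication by `q`. The equation at the ordered columns
    -- `(j, b)` therefore expresses the entry at `(b, j)` through the ordered one.
    · have h1 := congrFun (congrFun (congrFun (congrFun hf l) l) j) b
      have h2 := congrFun (congrFun (congrFun (congrFun hg l) l) j) b
      simp only [braidRow_apply, braidCol_apply, h, h.ne, lt_irrefl, if_true, if_false, one_smul,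
        heq l j b h.le] at h1 h2
      exact add_right_cancel (h1.symm.trans (by simpa using h2))
  · have h1 := congrFun (congrFun (congrFun (congrFun hf i) l) b) j
    have h2 := congrFun (congrFun (congrFun (congrFun hg i) l) b) j
    simp only [braidRow_apply, braidCol_apply, h, h.ne, if_true, if_false, one_smul,
      hlt i l _ _ h] at h1 h2
    exact add_right_cancel (h1.trans h2.symm)

end braiding

/-- The products `zˡ_b zⁱ_j` as a four-index tensor. -/
noncomputable def zTensor (q : ℂ) (l i b j : Fin 3) : GLq3 q := z q l b * z q i j

/-- This is the RTT form of the defining relations: the nine order types of the two index pairs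
reproduce the row, column, antidiagonal and diagonal relations. -/
lemma braidRow_zTensor (q : ℂ) [NeZero q] :
    braidRow q (zTensor q) = braidCol q (zTensor q) := by
  have hq : q ≠ 0 := NeZero.ne q
  ext l i b j
  simp only [braidRow_apply, braidCol_apply, zTensor]
  rcases lt_trichotomy l i with h | rfl | h <;> rcases lt_trichotomy b j with h' | rfl | h'
  · simp only [h, h.ne, h', h'.ne, if_true, if_false, no_anti q _ _ _ _ h h']
    module
  · simp only [h, h.ne, lt_irrefl, if_true, if_false, no_col q _ _ _ h]
    match_scalars; field_simp; ring
  · simp only [h, h.ne, h'.ne', h'.not_gt, if_true, if_false,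
      no_diag q _ _ _ _ h h']
    module
  · simp only [h', h'.ne, lt_irrefl, if_true, if_false, no_row q _ _ _ h']
    match_scalars; field_simp; ring
  · simp only [lt_irrefl, if_true, if_false]
  · simp only [h'.ne', h'.not_gt, lt_irrefl, if_true, if_false, no_row q _ _ _ h']
    match_scalars; field_simp
  · simp only [h.ne', h.not_gt, h', h'.ne, if_true, if_false, no_anti q _ _ _ _ h h',
      no_diag q _ _ _ _ h h']
    module
  · simp only [h.ne', h.not_gt, lt_irrefl, if_true, if_false, no_col q _ _ _ h]
    match_scalars; field_simp
  · simp only [h.ne', h.not_gt, h'.ne', h'.not_gt, if_false, no_anti q _ _ _ _ h h',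
      no_diag q _ _ _ _ h h']
    module

/-! ### Tensor form of the relations, weighted contraction, and extension to the algebra -/

section calculus

variable {q : ℂ} {Γ : Type*} [AddCommGroup Γ] [Module ℂ Γ] [Module (GLq3 q) Γ]
  [Module (GLq3 q)ᵐᵒᵖ Γ]

/-- Inverts the definition of the Maurer-Cartan forms, `dZ = Zθ`. This lets a row braiding of
`Z₁dZ₂` be traded for a column braiding of `Z₁Z₂`. -/
lemma sum_z_smul_theta [NeZero q] (C : FirstOrderCalculus (GLq3 q) Γ) (i j : Fin 3) :
    ∑ n, z q i n • theta C n j = C.d (z q i j) := by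
  simp only [theta, Finset.smul_sum, smul_smul]
  rw [Finset.sum_comm]
  simp only [← Finset.sum_smul, z_mul_antipodeZ, ite_smul, one_smul, zero_smul,
    Finset.sum_ite_eq, Finset.mem_univ, if_true]

/-- The forms `zˡ_b dzⁱ_j` as a four-index tensor. -/
def zdTensor (C : FirstOrderCalculus (GLq3 q) Γ) (l i b j : Fin 3) : Γ :=
  z q l b • C.d (z q i j)

variable [IsScalarTower ℂ (GLq3 q) Γ]

/-- The elements `zˡ_b zⁱ_j ω` as a four-index tensor. -/
noncomputable def zTensorSMul (q : ℂ) {Γ : Type*} [AddCommGroup Γ] [Module (GLq3 q) Γ] (ω : Γ)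
    (l i b j : Fin 3) : Γ := zTensor q l i b j • ω

lemma braidRow_zTensorSMul [NeZero q] (ω : Γ) :
    braidRow q (zTensorSMul q ω) = braidCol q (zTensorSMul q ω) := by
  ext l i b j
  have h := congrFun (congrFun (congrFun (congrFun (braidRow_zTensor q) l) i) b) j
  simp only [braidRow_apply, braidCol_apply, zTensorSMul, ← smul_assoc, ← add_smul] at h ⊢
  rw [h]

lemma braidRow_d_zTensor [NeZero q] (C : FirstOrderCalculus (GLq3 q) Γ) :
    braidRow q (fun l i b j => C.d (zTensor q l i b j)) =
      braidCol q (fun l i b j => C.d (zTensor q l i b j)) := by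
  ext l i b j
  have h := congrFun (congrFun (congrFun (congrFun (braidRow_zTensor q) l) i) b) j
  simp only [braidRow_apply, braidCol_apply, ← map_smul, ← map_add] at h ⊢
  rw [h]

/-- The common form of the commutation relations: `d(Z₁Z₂)` in terms of `Z₁ dZ₂` and `Z₁Z₂ ω`. -/
noncomputable def differentialTensor (C : FirstOrderCalculus (GLq3 q) Γ) (μ t s u : ℂ) (ω : Γ) :
    Fin 3 → Fin 3 → Fin 3 → Fin 3 → Γ :=
  t • (braidRow q (braidCol q (zdTensor C)) - μ • braidRow q (zdTensor C)
      - μ • braidCol q (zdTensor C) + (μ ^ 2 + 1) • zdTensor C)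
    + s • zTensorSMul q ω + u • braidRow q (zTensorSMul q ω)

/-- For commuting `R`, `R'` with `X² = λX + 1`, the product `(R - R')((R - μ)(R' - μ) + 1)` equals
`μ(μ - λ)(R - R')`. It vanishes for `μ = 0` and for `μ = λ`, the two values that occur. The terms in
`ω` are covered by `R(Z₁Z₂ω) = R'(Z₁Z₂ω)`. -/
lemma braidRow_differentialTensor [NeZero q] (C : FirstOrderCalculus (GLq3 q) Γ) {μ : ℂ}
    (hμ : μ * (q - q⁻¹ - μ) = 0) (t s u : ℂ) (ω : Γ) :
    braidRow q (differentialTensor C μ t s u ω) = braidCol q (differentialTensor C μ t s u ω) := by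
  simp only [differentialTensor, map_add, map_sub, map_smul, braidRow_braidRow, braidCol_braidCol,
    braidCol_braidRow, ← braidRow_zTensorSMul, smul_add, smul_sub, smul_smul]
  match_scalars <;>
    first | ring1 | linear_combination t * hμ | linear_combination -t * hμ

/-- Contraction of the row index `l` with the antipode, followed by the weighted trace over the
column index. -/
noncomputable def weightedContract (q : ℂ) {Γ : Type*} [AddCommGroup Γ] [Module ℂ Γ]
    [Module (GLq3 q) Γ] [IsScalarTower ℂ (GLq3 q) Γ] :
    (Fin 3 → Fin 3 → Fin 3 → Fin 3 → Γ) →ₗ[ℂ] (Fin 3 → Fin 3 → Γ) where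
  toFun f i j := ∑ a, (![q ^ 4, q ^ 2, 1] a) • ∑ l, antipodeZ q a l • f l i a j
  map_add' f g := by
    ext i j
    simp only [Pi.add_apply, smul_add, Finset.sum_add_distrib]
  map_smul' c f := by
    ext i j
    simp only [Pi.smul_apply, RingHom.id_apply, Finset.smul_sum]
    simp only [smul_comm c]

lemma weightedContract_apply (f : Fin 3 → Fin 3 → Fin 3 → Fin 3 → Γ) (i j : Fin 3) :
    weightedContract q f i j =
      ∑ a, (![q ^ 4, q ^ 2, 1] a) • ∑ l, antipodeZ q a l • f l i a j := rfl

lemma sum_antipodeZ_smul_z_smul [NeZero q] (a b : Fin 3) (ω : Γ) :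
    ∑ l, antipodeZ q a l • z q l b • ω = if a = b then ω else 0 := by
  simp only [smul_smul, ← Finset.sum_smul, antipodeZ_mul_z, ite_smul, one_smul, zero_smul]

/-- The row braiding moves the index `l` to the second factor, out of reach of a contraction with
`S(Z₁)`. After substituting `dZ = Zθ`, the RTT relation replaces it by a column braiding, which
leaves `l` on the first factor. -/
lemma braidRow_zdTensor [NeZero q] (C : FirstOrderCalculus (GLq3 q) Γ) (l i b j : Fin 3) :
    braidRow q (zdTensor C) l i b j =
      ∑ n, braidCol q (zTensorSMul q (theta C n j)) l i b n := by
  simp only [← braidRow_zTensorSMul, braidRow_apply, zdTensor, ← sum_z_smul_theta, zTensorSMul,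
    zTensor, mul_smul, Finset.smul_sum, Finset.sum_add_distrib]

lemma sum_antipodeZ_smul_braidCol [NeZero q] (ω : Γ) (a i b n : Fin 3) :
    ∑ l, antipodeZ q a l • braidCol q (zTensorSMul q ω) l i b n =
      (if b = n then q else 1) • (if a = n then z q i b • ω else 0)
        + (if b < n then q - q⁻¹ else 0) • (if a = b then z q i n • ω else 0) := by
  simp only [braidCol_apply, zTensorSMul, zTensor, mul_smul, smul_add, Finset.sum_add_distrib,
    smul_comm (antipodeZ q a _) (_ : ℂ), ← Finset.smul_sum, sum_antipodeZ_smul_z_smul]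

lemma sum_antipodeZ_smul_braidRow_zdTensor [NeZero q] (C : FirstOrderCalculus (GLq3 q) Γ)
    (a i b j : Fin 3) :
    ∑ l, antipodeZ q a l • braidRow q (zdTensor C) l i b j =
      ∑ n, ((if b = n then q else 1) • (if a = n then z q i b • theta C n j else 0)
        + (if b < n then q - q⁻¹ else 0) • (if a = b then z q i n • theta C n j else 0)) := by
  simp only [braidRow_zdTensor, Finset.smul_sum]
  rw [Finset.sum_comm]
  simp only [sum_antipodeZ_smul_braidCol]

lemma weightedContract_zTensorSMul [NeZero q] (ω : Γ) (i j : Fin 3) :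
    weightedContract q (zTensorSMul q ω) i j = (q ^ 4 + q ^ 2 + 1) • z q i j • ω := by
  simp only [weightedContract_apply, zTensorSMul, zTensor, mul_smul, sum_antipodeZ_smul_z_smul,
    if_true]
  simp only [Fin.sum_univ_three, Matrix.cons_val, one_smul, add_smul]

lemma weightedContract_zdTensor [NeZero q] (C : FirstOrderCalculus (GLq3 q) Γ) (i j : Fin 3) :
    weightedContract q (zdTensor C) i j = (q ^ 4 + q ^ 2 + 1) • C.d (z q i j) := by
  simp only [weightedContract_apply, zdTensor, sum_antipodeZ_smul_z_smul, if_true]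
  simp only [Fin.sum_univ_three, Matrix.cons_val, one_smul, add_smul]

/-- The weights `w = (q⁴, q², 1)` satisfy `q w_j + λ ∑_{a<j} w_a = q⁵` for every `j`: the weighted
partial trace of the Hecke braiding is a scalar. The same identity gives the two single braidings of
`zdTensor` below. -/
lemma weightedContract_braidRow_zTensorSMul [NeZero q] (ω : Γ) (i j : Fin 3) :
    weightedContract q (braidRow q (zTensorSMul q ω)) i j = q ^ 5 • z q i j • ω := by
  have hq : q ≠ 0 := NeZero.ne q
  simp only [weightedContract_apply, braidRow_zTensorSMul, sum_antipodeZ_smul_braidCol]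
  fin_cases j <;>
  · simp [Fin.sum_univ_three]
    generalize z q i _ • ω = x
    match_scalars
    field_simp
    try ring

lemma weightedContract_braidCol_zdTensor [NeZero q] (C : FirstOrderCalculus (GLq3 q) Γ)
    (i j : Fin 3) :
    weightedContract q (braidCol q (zdTensor C)) i j = q ^ 5 • C.d (z q i j) := by
  have hq : q ≠ 0 := NeZero.ne q
  simp only [weightedContract_apply, braidCol_apply, zdTensor, smul_add, Finset.sum_add_distrib,
    smul_comm (antipodeZ q _ _) (_ : ℂ), ← Finset.smul_sum, sum_antipodeZ_smul_z_smul]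
  fin_cases j <;>
  · simp [Fin.sum_univ_three]
    match_scalars
    field_simp
    try ring

lemma weightedContract_braidRow_zdTensor [NeZero q] (C : FirstOrderCalculus (GLq3 q) Γ)
    (i j : Fin 3) :
    weightedContract q (braidRow q (zdTensor C)) i j = q ^ 5 • C.d (z q i j) := by
  have hq : q ≠ 0 := NeZero.ne q
  simp only [weightedContract_apply, sum_antipodeZ_smul_braidRow_zdTensor, ← sum_z_smul_theta]
  simp [Fin.sum_univ_three]
  generalize z q i 0 • theta C 0 j = x₀, z q i 1 • theta C 1 j = x₁, z q i 2 • theta C 2 j = x₂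
  match_scalars <;> field_simp <;> ring

/-- The column braiding swaps the traced column index with `j`, so that after the row contraction
both indices of `θ` meet the weight, which produces `zⁱⱼ T`. What remains collapses to a multiple of
`dzⁱⱼ` by the partial trace identity. -/
lemma weightedContract_braidRow_braidCol_zdTensor [NeZero q] (C : FirstOrderCalculus (GLq3 q) Γ)
    (i j : Fin 3) :
    weightedContract q (braidRow q (braidCol q (zdTensor C))) i j =
      z q i j • trTheta C + (q - q⁻¹) • q ^ 5 • C.d (z q i j) := by
  have hq : q ≠ 0 := NeZero.ne q
  simp only [weightedContract_apply, ← braidCol_braidRow]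
  simp only [braidCol_apply, smul_add, Finset.sum_add_distrib,
    smul_comm (antipodeZ q _ _) (_ : ℂ), ← Finset.smul_sum, sum_antipodeZ_smul_braidRow_zdTensor,
    ← sum_z_smul_theta, trTheta]
  -- The products `z • θ` become opaque vectors, so that only complex coefficients are compared.
  obtain ⟨x, hx⟩ : ∃ x : Fin 3 → Fin 3 → Fin 3 → Γ, ∀ n a b, z q i n • theta C a b = x n a b :=
    ⟨_, fun _ _ _ => rfl⟩
  fin_cases j <;>
  · simp [Fin.sum_univ_three]
    simp only [smul_comm (z q _ _) (_ : ℂ), hx]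
    match_scalars <;> field_simp <;> ring

variable [SMulCommClass (GLq3 q) (GLq3 q)ᵐᵒᵖ Γ] [IsScalarTower ℂ (GLq3 q)ᵐᵒᵖ Γ]

/-- By the Leibniz rule the tensor splits into `(dZ₁)Z₂ + Z₁dZ₂`. Right multiplication by `zⁱⱼ`
commutes with the contraction, which turns `dZ₁` into `Tr_q θ`. -/
lemma weightedContract_d_zTensor [NeZero q] (C : FirstOrderCalculus (GLq3 q) Γ) (i j : Fin 3) :
    weightedContract q (fun l i b j => C.d (zTensor q l i b j)) i j =
      trTheta C <• z q i j + (q ^ 4 + q ^ 2 + 1) • C.d (z q i j) := by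
  have h : (fun l i b j => C.d (zTensor q l i b j)) =
      (fun l i b j => C.d (z q l b) <• z q i j) + zdTensor C := by
    ext l i b j
    exact C.leibniz _ _
  rw [h, map_add, Pi.add_apply, Pi.add_apply, weightedContract_zdTensor]
  congr 1
  simp only [weightedContract_apply, smul_comm (antipodeZ q _ _) (MulOpposite.op (z q i j)),
    smul_comm (_ : ℂ) (MulOpposite.op (z q i j)), ← Finset.smul_sum, trTheta, theta,
    Fin.sum_univ_three, Matrix.cons_val, one_smul]

/-- If `d(Z₁Z₂)` has the common form of the commutation relations, the commutator with `Tr_q θ` is a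
multiple of the differential on the generators `zⁱⱼ`. -/
lemma trTheta_commutator_z [NeZero q] {C : FirstOrderCalculus (GLq3 q) Γ} {μ t s u N : ℂ}
    (h : (fun l i b j => C.d (zTensor q l i b j)) = differentialTensor C μ t s u (trTheta C))
    (h1 : t + s * (q ^ 4 + q ^ 2 + 1) + u * q ^ 5 = 1)
    (hN : N = t * ((q - q⁻¹ - 2 * μ) * q ^ 5 + (μ ^ 2 + 1) * (q ^ 4 + q ^ 2 + 1))
      - (q ^ 4 + q ^ 2 + 1)) (i j : Fin 3) :
    trTheta C <• z q i j - z q i j • trTheta C = N • C.d (z q i j) := by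
  have key := weightedContract_d_zTensor C i j
  rw [h] at key
  simp only [differentialTensor, map_add, map_sub, map_smul, Pi.add_apply, Pi.sub_apply,
    Pi.smul_apply, weightedContract_zTensorSMul, weightedContract_zdTensor,
    weightedContract_braidRow_zTensorSMul, weightedContract_braidCol_zdTensor,
    weightedContract_braidRow_zdTensor, weightedContract_braidRow_braidCol_zdTensor] at key
  rw [← sub_eq_iff_eq_add] at key
  rw [← key, hN]
  generalize z q i j • trTheta C = x
  match_scalars
  · linear_combination h1
  · ring

/-- A derivation relation with the commutator of `ω` extends from the `zⁱⱼ` to the whole algebra. -/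
lemma commutator_eq_smul_d {C : FirstOrderCalculus (GLq3 q) Γ} {ω : Γ} {N : ℂ}
    (h : ∀ i j, ω <• z q i j - z q i j • ω = N • C.d (z q i j)) (a : GLq3 q) :
    ω <• a - a • ω = N • C.d a := by
  have := SMulCommClass.symm (GLq3 q) (GLq3 q)ᵐᵒᵖ Γ
  have d_one : C.d 1 = 0 := by simpa using C.leibniz 1 1
  have hmul : ∀ a b : GLq3 q, ω <• a - a • ω = N • C.d a → ω <• b - b • ω = N • C.d b →
      ω <• (a * b) - (a * b) • ω = N • C.d (a * b) := by
    intro a b ha hb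
    rw [C.leibniz, smul_add, smul_comm N (MulOpposite.op b), ← ha, smul_comm N a, ← hb,
      smul_sub, smul_sub, MulOpposite.op_mul, mul_smul, mul_smul, smul_comm a (MulOpposite.op b)]
    abel
  have hadd : ∀ a b : GLq3 q, ω <• a - a • ω = N • C.d a → ω <• b - b • ω = N • C.d b →
      ω <• (a + b) - (a + b) • ω = N • C.d (a + b) := by
    intro a b ha hb
    rw [map_add, smul_add, ← ha, ← hb, MulOpposite.op_add, add_smul, add_smul]
    abel
  have hsmul : ∀ (c : ℂ) (a : GLq3 q), ω <• a - a • ω = N • C.d a →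
      ω <• (c • a) - (c • a) • ω = N • C.d (c • a) := by
    intro c a ha
    rw [map_smul, smul_comm N c, ← ha, MulOpposite.op_smul, smul_assoc, smul_assoc, smul_sub]
  have hone : ω <• (1 : GLq3 q) - (1 : GLq3 q) • ω = N • C.d 1 := by
    simp [d_one]
  -- The equalizer of two derivations is a subalgebra, so only generators need to be checked.
  let K : Subalgebra ℂ (GLq3 q) :=
    { carrier := {a | ω <• a - a • ω = N • C.d a}
      mul_mem' := fun {a b} => hmul a b
      add_mem' := fun {a b} => hadd a b
      algebraMap_mem' := fun c => by
        rw [Algebra.algebraMap_eq_smul_one]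
        exact hsmul c 1 hone }
  have hz : ∀ i j, z q i j ∈ K := h
  have hdet : det q ∈ K := by
    have hm : ∀ i j k l m n, z q i j * z q k l * z q m n ∈ K := fun i j k l m n =>
      K.mul_mem (K.mul_mem (hz i j) (hz k l)) (hz m n)
    exact K.sub_mem (K.sub_mem (K.sub_mem (K.add_mem (K.add_mem (hm ..) (K.smul_mem (hm ..) _))
      (K.smul_mem (hm ..) _)) (K.smul_mem (hm ..) _)) (K.smul_mem (hm ..) _)) (K.smul_mem (hm ..) _)
  have hdetInv : detInv q ∈ K := by
    have h0 : ω <• det q - det q • ω = N • C.d (det q) := hdet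
    have h1 : C.d (det q) <• detInv q + det q • C.d (detInv q) = 0 := by
      rw [← C.leibniz, det_mul_detInv, d_one]
    change ω <• detInv q - detInv q • ω = N • C.d (detInv q)
    -- The derivative of an inverse, `d(𝒟⁻¹) = -𝒟⁻¹ (d𝒟) 𝒟⁻¹`, reduces the claim for `𝒟⁻¹` to the
    -- one for `𝒟`.
    have h2 : C.d (detInv q) = -(detInv q • C.d (det q) <• detInv q) := by
      have := congrArg (detInv q • ·) h1
      simp only [smul_add, smul_zero, smul_smul (detInv q) (det q), detInv_mul_det, one_smul] at this
      exact eq_neg_of_add_eq_zero_right this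
    rw [h2, smul_neg, smul_comm N (detInv q), smul_comm N (MulOpposite.op (detInv q)), ← h0,
      smul_sub, smul_sub, smul_smul (MulOpposite.op (detInv q)), ← MulOpposite.op_mul,
      det_mul_detInv, MulOpposite.op_one, one_smul, smul_comm (MulOpposite.op (detInv q)) (det q),
      smul_smul, detInv_mul_det, one_smul, neg_sub]
  obtain ⟨x, rfl⟩ := RingQuot.mkAlgHom_surjective ℂ (Rel q) a
  change mk q x ∈ K
  induction x using FreeAlgebra.induction with
  | grade0 c => rw [AlgHom.commutes]; exact K.algebraMap_mem c
  | grade1 g =>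
    cases g with
    | z i j => exact hz i j
    | detInv => exact hdetInv
  | mul x y hx hy => rw [map_mul]; exact K.mul_mem hx hy
  | add x y hx hy => rw [map_add]; exact K.add_mem hx hy

end calculus
-- The two families in tensor form
section calculi

variable {q t : ℂ} [NeZero q] {Γ : Type*} [AddCommGroup Γ] [Module ℂ Γ] [Module (GLq3 q) Γ]
  [Module (GLq3 q)ᵐᵒᵖ Γ] [IsScalarTower ℂ (GLq3 q) Γ] {C : FirstOrderCalculus (GLq3 q) Γ}

/-- Here `μ = λ`, so the braidings enter through their inverses. The coefficient of the swapped
product `zⁱ_l zᵏ_j T` in `comm_diag` forces `u = qβ`. On coinciding indices `R` acts by `q`, so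
`comm_same` forces `s + qu = σ`. -/
lemma IsGamma₁.d_zTensor (h : IsGamma₁ t C) :
    (fun l i b j => C.d (zTensor q l i b j)) =
      differentialTensor C (q - q⁻¹) t (sigma₁ q t - q ^ 2 * beta₁ q t) (q * beta₁ q t)
        (trTheta C) := by
  have hq : q ≠ 0 := NeZero.ne q
  refine eq_of_braidRow_eq_braidCol (braidRow_d_zTensor C)
    (braidRow_differentialTensor C (by ring) _ _ _ _) (fun l i b j hl => ?_) (fun l b j hb => ?_)
  · rcases lt_trichotomy b j with hb | rfl | hb
    · simp only [zTensor, C.leibniz, h.comm_diag l i b j hl hb]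
      simp only [differentialTensor, braidRow_apply, braidCol_apply, zdTensor, zTensorSMul, zTensor,
        Pi.add_apply, Pi.sub_apply, Pi.smul_apply, hl, hl.ne, hb, hb.ne,
        if_true, if_false, sub_smul, smul_assoc, z_anti q l i j b hl hb]
      generalize z q l b • C.d (z q i j) = x₁, z q l j • C.d (z q i b) = x₂,
        z q i b • C.d (z q l j) = x₃, z q i j • C.d (z q l b) = x₄,
        (z q l b * z q i j) • trTheta C = y₁, (z q i b * z q l j) • trTheta C = y₂
      match_scalars <;> field_simp <;> ring
    · simp only [zTensor, C.leibniz, h.comm_col l i b hl]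
      simp only [differentialTensor, braidRow_apply, braidCol_apply, zdTensor, zTensorSMul, zTensor,
        Pi.add_apply, Pi.sub_apply, Pi.smul_apply, hl, hl.ne, lt_irrefl,
        if_true, if_false, sub_smul, smul_assoc, no_col q l i b hl]
      generalize z q l b • C.d (z q i b) = x₁, z q i b • C.d (z q l b) = x₂,
        (z q l b * z q i b) • trTheta C = y
      match_scalars <;> field_simp <;> ring
    · simp only [zTensor, C.leibniz, h.comm_anti l i b j hl hb]
      simp only [differentialTensor, braidRow_apply, braidCol_apply, zdTensor, zTensorSMul, zTensor,
        Pi.add_apply, Pi.sub_apply, Pi.smul_apply, hl, hl.ne, hb.ne', hb.not_gt,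
        if_true, if_false, sub_smul, smul_assoc,
        no_diag q l i j b hl hb]
      generalize z q l b • C.d (z q i j) = x₁, z q l j • C.d (z q i b) = x₂,
        z q i b • C.d (z q l j) = x₃, z q i j • C.d (z q l b) = x₄,
        (z q l b * z q i j) • trTheta C = y₁, (z q l j * z q i b) • trTheta C = y₂
      match_scalars <;> field_simp <;> ring
  · rcases hb.lt_or_eq with hb | rfl
    · simp only [zTensor, C.leibniz, h.comm_row l b j hb]
      simp only [differentialTensor, braidRow_apply, braidCol_apply, zdTensor, zTensorSMul, zTensor,
        Pi.add_apply, Pi.sub_apply, Pi.smul_apply, lt_irrefl, hb, hb.ne,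
        if_true, if_false, sub_smul]
      generalize z q l b • C.d (z q l j) = x₁, z q l j • C.d (z q l b) = x₂,
        (z q l b * z q l j) • trTheta C = y
      match_scalars <;> field_simp <;> ring
    · simp only [zTensor, C.leibniz, h.comm_same l b]
      simp only [differentialTensor, braidRow_apply, braidCol_apply, zdTensor, zTensorSMul, zTensor,
        Pi.add_apply, Pi.sub_apply, Pi.smul_apply, lt_irrefl, if_true, if_false]
      generalize z q l b • C.d (z q l b) = x, (z q l b * z q l b) • trTheta C = y
      match_scalars <;> field_simp <;> ring

/-- Here `μ = 0`. The same comparison gives `u = q⁻¹β̂` and `s = σ̂ - qu = σ̂ - β̂`. -/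
lemma IsGamma₂.d_zTensor (h : IsGamma₂ t C) :
    (fun l i b j => C.d (zTensor q l i b j)) =
      differentialTensor C 0 t (sigma₂ q t - beta₂ q t) (q⁻¹ * beta₂ q t) (trTheta C) := by
  have hq : q ≠ 0 := NeZero.ne q
  refine eq_of_braidRow_eq_braidCol (braidRow_d_zTensor C)
    (braidRow_differentialTensor C (by ring) _ _ _ _) (fun l i b j hl => ?_) (fun l b j hb => ?_)
  · rcases lt_trichotomy b j with hb | rfl | hb
    · simp only [zTensor, C.leibniz, h.comm_diag l i b j hl hb]
      simp only [differentialTensor, braidRow_apply, braidCol_apply, zdTensor, zTensorSMul, zTensor,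
        Pi.add_apply, Pi.sub_apply, Pi.smul_apply, hl, hl.ne, hb, hb.ne,
        if_true, if_false, sub_smul, smul_assoc, z_anti q l i j b hl hb]
      generalize z q l b • C.d (z q i j) = x₁, z q l j • C.d (z q i b) = x₂,
        z q i b • C.d (z q l j) = x₃, z q i j • C.d (z q l b) = x₄,
        (z q l b * z q i j) • trTheta C = y₁, (z q i b * z q l j) • trTheta C = y₂
      match_scalars <;> field_simp <;> ring
    · simp only [zTensor, C.leibniz, h.comm_col l i b hl]
      simp only [differentialTensor, braidRow_apply, braidCol_apply, zdTensor, zTensorSMul, zTensor,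
        Pi.add_apply, Pi.sub_apply, Pi.smul_apply, hl, hl.ne, lt_irrefl,
        if_true, if_false, sub_smul, smul_assoc, no_col q l i b hl]
      generalize z q l b • C.d (z q i b) = x₁, z q i b • C.d (z q l b) = x₂,
        (z q l b * z q i b) • trTheta C = y
      match_scalars <;> field_simp <;> ring
    · simp only [zTensor, C.leibniz, h.comm_anti l i b j hl hb]
      simp only [differentialTensor, braidRow_apply, braidCol_apply, zdTensor, zTensorSMul, zTensor,
        Pi.add_apply, Pi.sub_apply, Pi.smul_apply, hl, hl.ne, hb.ne', hb.not_gt,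
        if_true, if_false, sub_smul, smul_assoc,
        no_diag q l i j b hl hb]
      generalize z q l b • C.d (z q i j) = x₁, z q l j • C.d (z q i b) = x₂,
        z q i b • C.d (z q l j) = x₃, z q i j • C.d (z q l b) = x₄,
        (z q l b * z q i j) • trTheta C = y₁, (z q l j * z q i b) • trTheta C = y₂
      match_scalars <;> field_simp <;> ring
  · rcases hb.lt_or_eq with hb | rfl
    · simp only [zTensor, C.leibniz, h.comm_row l b j hb]
      simp only [differentialTensor, braidRow_apply, braidCol_apply, zdTensor, zTensorSMul, zTensor,
        Pi.add_apply, Pi.sub_apply, Pi.smul_apply, lt_irrefl, hb, hb.ne,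
        if_true, if_false, sub_smul]
      generalize z q l b • C.d (z q l j) = x₁, z q l j • C.d (z q l b) = x₂,
        (z q l b * z q l j) • trTheta C = y
      match_scalars <;> field_simp <;> ring
    · simp only [zTensor, C.leibniz, h.comm_same l b]
      simp only [differentialTensor, braidRow_apply, braidCol_apply, zdTensor, zTensorSMul, zTensor,
        Pi.add_apply, Pi.sub_apply, Pi.smul_apply, lt_irrefl, if_true, if_false]
      generalize z q l b • C.d (z q l b) = x, (z q l b * z q l b) • trTheta C = y
      match_scalars <;> field_simp <;> ring

end calculi

end GLq3

theorem mainTheorem5 (q t : ℂ) [NeZero q] (hq1 : q ≠ 1) (hq2 : q ≠ -1) (hq3 : q ≠ Complex.I)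
    (hq4 : q ≠ -Complex.I) (ht : t ≠ 0) {Γ : Type*} [AddCommGroup Γ] [Module ℂ Γ]
    [Module (GLq3 q) Γ] [Module (GLq3 q)ᵐᵒᵖ Γ] [SMulCommClass (GLq3 q) (GLq3 q)ᵐᵒᵖ Γ]
    [IsScalarTower ℂ (GLq3 q) Γ] [IsScalarTower ℂ (GLq3 q)ᵐᵒᵖ Γ]
    (C : FirstOrderCalculus (GLq3 q) Γ) :
    ((q ^ 6 + q ^ 4 + 1) * t - (q ^ 6 + q ^ 4 + q ^ 2) ≠ 0 → GLq3.IsGamma₁ t C →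
      GLq3.norm₁ q t ≠ 0 ∧ ∀ a : GLq3 q,
        C.d a = (1 / GLq3.norm₁ q t) • (GLq3.trTheta C <• a - a • GLq3.trTheta C)) ∧
    ((q ^ 6 + q ^ 2 + 1) * t - (q ^ 4 + q ^ 2 + 1) ≠ 0 → GLq3.IsGamma₂ t C →
      GLq3.norm₂ q t ≠ 0 ∧ ∀ a : GLq3 q,
        C.d a = (1 / GLq3.norm₂ q t) • (GLq3.trTheta C <• a - a • GLq3.trTheta C)) := by
  have hq : q ≠ 0 := NeZero.ne q
  constructor
  · intro h hC
    have h0 : q ^ 4 * (q ^ 2 + 1) * (t - 1) - q ^ 2 + t ≠ 0 := by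
      intro h'
      exact h (by linear_combination h')
    have hN : GLq3.norm₁ q t ≠ 0 :=
      mul_ne_zero (one_div_ne_zero (pow_ne_zero 2 hq)) h0
    refine ⟨hN, fun a => ?_⟩
    rw [one_div, eq_inv_smul_iff₀ hN]
    refine (GLq3.commutator_eq_smul_d (GLq3.trTheta_commutator_z hC.d_zTensor ?_ ?_) a).symm
    -- The coefficient of `zⁱⱼ T`: the goal amounts to `t - 1 + (q⁴ + q² + 1)σ - (q⁴ + q²)β = 0`.
    -- The common denominator is kept as one nonzero atom `D` until it has been cleared.
    · rw [GLq3.sigma₁, GLq3.beta₁]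
      generalize hD : q ^ 4 * (q ^ 2 + 1) * (t - 1) - q ^ 2 + t = D at h0 ⊢
      field_simp
      rw [← hD]
      ring
    · rw [GLq3.norm₁]
      field_simp
      ring
  · intro h hC
    have hN : GLq3.norm₂ q t ≠ 0 := by
      intro h'
      exact h (by rw [GLq3.norm₂] at h'; linear_combination h')
    refine ⟨hN, fun a => ?_⟩
    rw [one_div, eq_inv_smul_iff₀ hN]
    refine (GLq3.commutator_eq_smul_d (GLq3.trTheta_commutator_z hC.d_zTensor ?_ ?_) a).symm
    -- Here the coefficient condition is `t - 1 + (q⁴ + q² + 1)σ̂ - (q² + 1)β̂ = 0`, and the common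
    -- denominator is `𝒩` itself.
    · rw [GLq3.norm₂] at hN
      rw [GLq3.sigma₂, GLq3.beta₂]
      generalize hD : q ^ 4 * (q ^ 2 * t - 1) + (q ^ 2 + 1) * (t - 1) = D at hN ⊢
      field_simp
      rw [← hD]
      ring
    · rw [GLq3.norm₂]
      field_simp
      ring
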